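/- Let $d\ge 0$ and let $\alpha,\beta$ be Borel probability measures on $\mathbb{R}^d$ with finite second moments, $\int \|x\|^2\,d\alpha(x)<\infty$ and $\int\|y\|^2\,d\beta(y)<\infty$, and suppose that $\alpha$ has a density with respect to the Lebesgue measure. A transport map from $\alpha$ to $\beta$ is an ($\alpha$-almost everywhere defined) measurable map $T:\mathbb{R}^d\to\mathbb{R}^d$ with $T_\sharp\alpha=\beta$; it is an optimal Monge map if it minimizes $\int \|x-T(x)\|^2\,d\alpha(x)$ among all transport maps from $\alpha$ to $\beta$. We say that $T$ is the gradient of a convex function if there is a proper convex function $\varphi:\mathbb{R}^d\to\mathbb{R}\cup\{+\infty\}$ that, at $\alpha$-almost every $x$, is finite in a neighbourhood of $x$ and differentiable at $x$ with $\nabla\varphi(x)=T(x)$. Then there exists an optimal Monge map $T$ from $\alpha$ to $\beta$, and it is unique up to equality $\alpha$-almost everywhere. Moreover, $T$ is the gradient of a convex function $\varphi$, and it is, up to equality $\alpha$-almost everywhere, the only gradient of a convex function with $(\nabla\varphi)_\sharp\alpha=\beta$. In particular, a transport map from $\alpha$ to $\beta$ is an optimal Monge map if and only if it is the gradient of a convex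 function. -/

import Mathlib

open MeasureTheory Filter Topology
open scoped ENNReal

namespace Brenier

/-- `α` has a density with respect to the Lebesgue measure of `ℝ^d`. -/
def HasLebesgueDensity {d : ℕ} (α : Measure (EuclideanSpace ℝ (Fin d))) : Prop :=
  ∃ ρ : EuclideanSpace ℝ (Fin d) → ℝ≥0∞, Measurable ρ ∧ α = volume.withDensity ρ

/-- `T` is admissible for the Monge problem: `T_♯ α = β`. Maps are taken up to `α`-null sets,
so only almost-everywhere measurability is required. -/
def IsTransportMap {d : ℕ} (α β : Measure (EuclideanSpace ℝ (Fin d)))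
    (T : EuclideanSpace ℝ (Fin d) → EuclideanSpace ℝ (Fin d)) : Prop :=
  AEMeasurable T α ∧ α.map T = β

/-- The Monge cost `∫ ‖x - T x‖² dα(x)`, with values in `[0, ∞]`. -/
noncomputable def mongeCost {d : ℕ} (α : Measure (EuclideanSpace ℝ (Fin d)))
    (T : EuclideanSpace ℝ (Fin d) → EuclideanSpace ℝ (Fin d)) : ℝ≥0∞ :=
  ∫⁻ x, ‖x - T x‖ₑ ^ 2 ∂α

/-- `T` solves the Monge problem from `α` to `β` for the cost `‖x - y‖²`. -/
def IsOptimalMongeMap {d : ℕ} (α β : Measure (EuclideanSpace ℝ (Fin d)))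
    (T : EuclideanSpace ℝ (Fin d) → EuclideanSpace ℝ (Fin d)) : Prop :=
  IsTransportMap α β T ∧ ∀ S, IsTransportMap α β S → mongeCost α T ≤ mongeCost α S

/-- Proper convex functions `ℝ^d → ℝ ∪ {+∞}`: convexity is convexity of the epigraph. -/
structure IsProperConvex {d : ℕ} (φ : EuclideanSpace ℝ (Fin d) → EReal) : Prop where
  ne_bot : ∀ x, φ x ≠ ⊥
  exists_ne_top : ∃ x, φ x ≠ ⊤
  convex_epigraph : Convex ℝ {p : EuclideanSpace ℝ (Fin d) × ℝ | φ p.1 ≤ (p.2 : EReal)}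

/-- `φ` is finite near `x` and differentiable at `x` with gradient `g`. -/
def HasExtGradientAt {d : ℕ} (φ : EuclideanSpace ℝ (Fin d) → EReal)
    (g x : EuclideanSpace ℝ (Fin d)) : Prop :=
  (∀ᶠ z in 𝓝 x, φ z ≠ ⊥ ∧ φ z ≠ ⊤) ∧ HasGradientAt (fun z => (φ z).toReal) g x

/-- `T = ∇φ` holds `α`-almost everywhere for some convex `φ : ℝ^d → ℝ ∪ {+∞}`
(in particular `φ` is differentiable `α`-almost everywhere). -/
def IsGradientOfConvex {d : ℕ} (α : Measure (EuclideanSpace ℝ (Fin d)))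
    (T : EuclideanSpace ℝ (Fin d) → EuclideanSpace ℝ (Fin d)) : Prop :=
  ∃ φ : EuclideanSpace ℝ (Fin d) → EReal,
    IsProperConvex φ ∧ ∀ᵐ x ∂α, HasExtGradientAt φ (T x) x

end Brenier

namespace Brenier

open scoped NNReal

/-! Among plans with marginals `α`, `β`, minimizing the quadratic cost amounts to maximizing the
correlation `∫ ⟪x, y⟫`. A maximizer exists by weak compactness, and its support is cyclically
monotone (`IsCoupling.sum_inner_perm_le`), hence lies in the subdifferential of a convex `φ` by
Rockafellar's construction. Since `α` is absolutely continuous, `φ` is differentiable `α`-a.e.; the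
subdifferential is then a single point, so the plan sits on the graph of `∇φ`, which is a transport
map.

Conversely, if `S = ∇φ` is any transport map, Fenchel's inequality `⟪x, y⟫ ≤ φ x + φ* y`, with
equality at `y = S x`, integrates to show that `S` beats every plan, and that equality forces a plan
onto the graph of `S` (`IsGradientOfConvex.maximal`). This gives optimality and both uniqueness
claims. -/

/-- `π` is a transport plan between `α` and `β`: its marginals are `α` and `β`. -/
structure IsCoupling {X Y : Type*} [MeasurableSpace X] [MeasurableSpace Y]
    (α : Measure X) (β : Measure Y) (π : Measure (X × Y)) : Prop where
  map_fst : π.map Prod.fst = α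
  map_snd : π.map Prod.snd = β

/-! ### Optimal plans by weak compactness -/

section Existence

variable {X Y : Type*} [MeasurableSpace X] [MeasurableSpace Y]

theorem IsCoupling.isProbabilityMeasure {α : Measure X} {β : Measure Y} [IsProbabilityMeasure α]
    {π : Measure (X × Y)} (h : IsCoupling α β π) : IsProbabilityMeasure π := by
  constructor
  have := measure_univ (μ := α)
  rwa [← h.map_fst, Measure.map_apply measurable_fst MeasurableSet.univ, Set.preimage_univ] at this

theorem isCoupling_prod (α : Measure X) (β : Measure Y) [IsProbabilityMeasure α]
    [IsProbabilityMeasure β] : IsCoupling α β (α.prod β) :=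
  ⟨measurePreserving_fst.map_eq, measurePreserving_snd.map_eq⟩

theorem isCoupling_graph {α : Measure X} {S : X → Y} (hS : AEMeasurable S α) :
    IsCoupling α (α.map S) (α.map fun x => (x, S x)) := by
  have h : AEMeasurable (fun x => (x, S x)) α := aemeasurable_id.prodMk hS
  constructor
  · rw [AEMeasurable.map_map_of_aemeasurable measurable_fst.aemeasurable h]
    exact Measure.map_id
  · rw [AEMeasurable.map_map_of_aemeasurable measurable_snd.aemeasurable h]
    rfl

theorem IsCoupling.integrable_comp_fst {α : Measure X} {β : Measure Y} {π : Measure (X × Y)}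
    (h : IsCoupling α β π) {f : X → ℝ} (hf : Integrable f α) :
    Integrable (fun p => f p.1) π :=
  Integrable.comp_measurable (by rwa [h.map_fst]) measurable_fst

theorem IsCoupling.integrable_comp_snd {α : Measure X} {β : Measure Y} {π : Measure (X × Y)}
    (h : IsCoupling α β π) {f : Y → ℝ} (hf : Integrable f β) :
    Integrable (fun p => f p.2) π :=
  Integrable.comp_measurable (by rwa [h.map_snd]) measurable_snd

theorem IsCoupling.integral_comp_fst {α : Measure X} {β : Measure Y} {π : Measure (X × Y)}
    (h : IsCoupling α β π) {f : X → ℝ} (hf : Integrable f α) :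
    ∫ p, f p.1 ∂π = ∫ x, f x ∂α := by
  have hf' := hf.aestronglyMeasurable
  rw [← h.map_fst] at hf' ⊢
  exact (integral_map measurable_fst.aemeasurable hf').symm

theorem IsCoupling.integral_comp_snd {α : Measure X} {β : Measure Y} {π : Measure (X × Y)}
    (h : IsCoupling α β π) {f : Y → ℝ} (hf : Integrable f β) :
    ∫ p, f p.2 ∂π = ∫ x, f x ∂β := by
  have hf' := hf.aestronglyMeasurable
  rw [← h.map_snd] at hf' ⊢
  exact (integral_map measurable_snd.aemeasurable hf').symm

/-- The transport cost of a continuous cost function is lower semicontinuous in the plan. -/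
theorem lowerSemicontinuous_lintegral [TopologicalSpace X] [OpensMeasurableSpace X]
    {c : X → ℝ≥0} (hc : Continuous c) :
    LowerSemicontinuous fun μ : ProbabilityMeasure X => ∫⁻ x, c x ∂(μ : Measure X) := by
  have key : ∀ μ : ProbabilityMeasure X, ∫⁻ x, c x ∂(μ : Measure X) =
      ⨆ n : ℕ, ∫⁻ x, (min (c x) n : ℝ≥0) ∂(μ : Measure X) := by
    intro μ
    rw [← lintegral_iSup]
    · refine lintegral_congr fun x => le_antisymm ?_ ?_
      · obtain ⟨n, hn⟩ := exists_nat_ge (c x)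
        refine le_iSup_of_le n ?_
        rw [min_eq_left hn]
      · exact iSup_le fun n => ENNReal.coe_le_coe.2 (min_le_left _ _)
    · exact fun n => (hc.min continuous_const).measurable.coe_nnreal_ennreal
    · intro m n hmn x
      exact ENNReal.coe_le_coe.2 (min_le_min_left _ (Nat.cast_le.2 hmn))
  simp_rw [key]
  refine lowerSemicontinuous_iSup fun n => Continuous.lowerSemicontinuous ?_
  -- Each truncated cost is bounded and continuous, so its integral is weakly continuous. The
  -- constant `2 * n` is a crude bound on distances between values in `[0, n]`.
  let f : BoundedContinuousFunction X ℝ≥0 :=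
    BoundedContinuousFunction.mkOfBound ⟨fun x => min (c x) n, hc.min continuous_const⟩ (2 * n) (by
      intro x y
      have hx : (min (c x) (n : ℝ≥0) : ℝ≥0) ≤ n := min_le_right _ _
      have hy : (min (c y) (n : ℝ≥0) : ℝ≥0) ≤ n := min_le_right _ _
      have hx' : ((min (c x) (n : ℝ≥0) : ℝ≥0) : ℝ) ≤ n := by exact_mod_cast hx
      have hy' : ((min (c y) (n : ℝ≥0) : ℝ≥0) : ℝ) ≤ n := by exact_mod_cast hy
      have h0 := (min (c x) (n : ℝ≥0)).coe_nonneg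
      have h1 := (min (c y) (n : ℝ≥0)).coe_nonneg
      simp only [ContinuousMap.coe_mk, NNReal.dist_eq]
      rw [abs_le]
      constructor <;> linarith)
  exact continuous_iff_continuousAt.2 fun μ =>
    (ProbabilityMeasure.tendsto_iff_forall_lintegral_tendsto.1 tendsto_id) f

/-- Existence of optimal transport plans for continuous nonnegative costs. -/
theorem exists_optimal_coupling [TopologicalSpace X] [PolishSpace X] [BorelSpace X]
    [TopologicalSpace Y] [PolishSpace Y] [BorelSpace Y]
    (α : Measure X) (β : Measure Y) [IsProbabilityMeasure α] [IsProbabilityMeasure β]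
    {c : X × Y → ℝ≥0} (hc : Continuous c) :
    ∃ π, IsCoupling α β π ∧ ∀ π', IsCoupling α β π' → ∫⁻ p, c p ∂π ≤ ∫⁻ p, c p ∂π' := by
  let K : Set (ProbabilityMeasure (X × Y)) := {π | IsCoupling α β (π : Measure (X × Y))}
  have hK : K = {π | π.map measurable_fst.aemeasurable = (⟨α, ‹_›⟩ : ProbabilityMeasure X)} ∩
      {π | π.map measurable_snd.aemeasurable = (⟨β, ‹_›⟩ : ProbabilityMeasure Y)} := by
    ext π
    exact ⟨fun h => ⟨Subtype.ext h.1, Subtype.ext h.2⟩,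
      fun h => ⟨congrArg Subtype.val h.1, congrArg Subtype.val h.2⟩⟩
  have hclosed : IsClosed K := by
    rw [hK]
    exact (isClosed_singleton.preimage (ProbabilityMeasure.continuous_map continuous_fst)).inter
      (isClosed_singleton.preimage (ProbabilityMeasure.continuous_map continuous_snd))
  -- Tightness of a set of plans follows from tightness of the two sets of marginals, here
  -- singletons; Prokhorov's theorem then gives compactness.
  have htight :
      IsTightMeasureSet {((π : ProbabilityMeasure (X × Y)) : Measure (X × Y)) | π ∈ K} := by
    refine IsTightMeasureSet.prodMk ?_ ?_
    · refine (isTightMeasureSet_singleton (μ := α)).subset ?_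
      rintro _ ⟨_, ⟨π, hπ, rfl⟩, rfl⟩
      exact hπ.1
    · refine (isTightMeasureSet_singleton (μ := β)).subset ?_
      rintro _ ⟨_, ⟨π, hπ, rfl⟩, rfl⟩
      exact hπ.2
  have hcomp : IsCompact K := by
    have := isCompact_closure_of_isTightMeasureSet htight
    rwa [hclosed.closure_eq] at this
  obtain ⟨π, hπ, hmin⟩ := LowerSemicontinuousOn.exists_isMinOn
    (⟨⟨α.prod β, inferInstance⟩, isCoupling_prod α β⟩ : K.Nonempty) hcomp
    ((lowerSemicontinuous_lintegral hc).lowerSemicontinuousOn K)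
  refine ⟨π, hπ, fun π' hπ' => ?_⟩
  exact hmin (a := ⟨π', hπ'.isProbabilityMeasure⟩) hπ'

end Existence

/-! ### Quadratic cost, correlation and cyclical monotonicity -/

section Quadratic

variable {E : Type*} [NormedAddCommGroup E] [InnerProductSpace ℝ E] [FiniteDimensional ℝ E]
  [MeasurableSpace E] [BorelSpace E] {α β : Measure E} {π : Measure (E × E)}

theorem IsCoupling.integrable_inner (h : IsCoupling α β π)
    (hα2 : Integrable (fun x => ‖x‖ ^ 2) α) (hβ2 : Integrable (fun y => ‖y‖ ^ 2) β) :
    Integrable (fun p : E × E => inner ℝ p.1 p.2) π := by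
  refine ((h.integrable_comp_fst hα2).add (h.integrable_comp_snd hβ2)).mono'
    (by fun_prop) (ae_of_all _ fun p => ?_)
  have := norm_inner_le_norm (𝕜 := ℝ) p.1 p.2
  simp only [Pi.add_apply]
  nlinarith [sq_nonneg (‖p.1‖ - ‖p.2‖), sq_nonneg ‖p.1‖, sq_nonneg ‖p.2‖]

/-- Expansion of the square. Nonnegativity is kept because `ENNReal.ofReal` truncates at zero: it
allows costs to be compared as real numbers. -/
theorem IsCoupling.lintegral_enorm_sub_sq (h : IsCoupling α β π)
    (hα2 : Integrable (fun x => ‖x‖ ^ 2) α) (hβ2 : Integrable (fun y => ‖y‖ ^ 2) β) :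
    ∫⁻ p, ‖p.1 - p.2‖ₑ ^ 2 ∂π =
      ENNReal.ofReal (∫ x, ‖x‖ ^ 2 ∂α + ∫ y, ‖y‖ ^ 2 ∂β - 2 * ∫ p, inner ℝ p.1 p.2 ∂π) ∧
    0 ≤ ∫ x, ‖x‖ ^ 2 ∂α + ∫ y, ‖y‖ ^ 2 ∂β - 2 * ∫ p, inner ℝ p.1 p.2 ∂π := by
  have hi := h.integrable_inner hα2 hβ2
  have h1 := h.integrable_comp_fst hα2
  have h2 := h.integrable_comp_snd hβ2
  have heq : ∀ p : E × E, ‖p.1 - p.2‖ ^ 2 = ‖p.1‖ ^ 2 + ‖p.2‖ ^ 2 - 2 * inner ℝ p.1 p.2 := by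
    intro p
    rw [norm_sub_sq_real]
    ring
  have hinteg : ∫ p, ‖p.1 - p.2‖ ^ 2 ∂π =
      ∫ x, ‖x‖ ^ 2 ∂α + ∫ y, ‖y‖ ^ 2 ∂β - 2 * ∫ p, inner ℝ p.1 p.2 ∂π := by
    simp_rw [heq]
    rw [integral_sub (f := fun p : E × E => ‖p.1‖ ^ 2 + ‖p.2‖ ^ 2) (h1.add h2) (hi.const_mul 2),
      integral_add h1 h2, integral_const_mul,
      h.integral_comp_fst hα2, h.integral_comp_snd hβ2]
  have hsq : Integrable (fun p : E × E => ‖p.1 - p.2‖ ^ 2) π := by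
    simp_rw [heq]
    exact (h1.add h2).sub (hi.const_mul 2)
  rw [← hinteg]
  refine ⟨?_, integral_nonneg fun p => sq_nonneg _⟩
  rw [ofReal_integral_eq_lintegral_ofReal hsq (ae_of_all _ fun p => sq_nonneg _)]
  refine lintegral_congr fun p => ?_
  rw [ENNReal.ofReal_pow (norm_nonneg _), ofReal_norm]

/-- Minimizing the quadratic cost is the same as maximizing the correlation. -/
theorem IsCoupling.lintegral_le_iff {π' : Measure (E × E)} (h : IsCoupling α β π)
    (h' : IsCoupling α β π')
    (hα2 : Integrable (fun x => ‖x‖ ^ 2) α) (hβ2 : Integrable (fun y => ‖y‖ ^ 2) β) :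
    ∫⁻ p, ‖p.1 - p.2‖ₑ ^ 2 ∂π ≤ ∫⁻ p, ‖p.1 - p.2‖ₑ ^ 2 ∂π' ↔
      ∫ p, inner ℝ p.1 p.2 ∂π' ≤ ∫ p, inner ℝ p.1 p.2 ∂π := by
  rw [(h.lintegral_enorm_sub_sq hα2 hβ2).1, (h'.lintegral_enorm_sub_sq hα2 hβ2).1,
    ENNReal.ofReal_le_ofReal_iff (h'.lintegral_enorm_sub_sq hα2 hβ2).2]
  constructor <;> intro <;> linarith

/-- Existence of a transport plan maximizing the correlation. -/
theorem exists_maximal_coupling (α β : Measure E) [IsProbabilityMeasure α] [IsProbabilityMeasure β]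
    (hα2 : Integrable (fun x => ‖x‖ ^ 2) α) (hβ2 : Integrable (fun y => ‖y‖ ^ 2) β) :
    ∃ π, IsCoupling α β π ∧ ∀ π', IsCoupling α β π' →
      ∫ p, inner ℝ p.1 p.2 ∂π' ≤ ∫ p, inner ℝ p.1 p.2 ∂π := by
  obtain ⟨π, hπ, hopt⟩ := exists_optimal_coupling α β
    (c := fun p : E × E => ‖p.1 - p.2‖₊ ^ 2) (by fun_prop)
  refine ⟨π, hπ, fun π' hπ' => (hπ.lintegral_le_iff hπ' hα2 hβ2).1 ?_⟩
  simpa [enorm_eq_nnnorm] using hopt π' hπ'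

/-- The support of a transport plan maximizing the correlation is cyclically monotone. -/
theorem IsCoupling.sum_inner_perm_le [IsProbabilityMeasure α] (h : IsCoupling α β π)
    (hα2 : Integrable (fun x => ‖x‖ ^ 2) α) (hβ2 : Integrable (fun y => ‖y‖ ^ 2) β)
    (hmax : ∀ π', IsCoupling α β π' → ∫ p, inner ℝ p.1 p.2 ∂π' ≤ ∫ p, inner ℝ p.1 p.2 ∂π)
    {ι : Type*} [Fintype ι] (σ : Equiv.Perm ι) (z : ι → E × E) (hz : ∀ i, z i ∈ π.support) :
    ∑ i, inner ℝ (z (σ i)).1 (z i).2 ≤ ∑ i, inner ℝ (z i).1 (z i).2 := by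
  classical
  have := h.isProbabilityMeasure
  -- Draw independent samples from `π` and permute their first coordinates on the event `A` where
  -- this raises the total correlation.
  let P : Measure (ι → E × E) := Measure.pi fun _ => π
  let G : (ι → E × E) → ℝ := fun w =>
    ∑ i, (inner ℝ (w (σ i)).1 (w i).2 - inner ℝ (w i).1 (w i).2)
  have hG : Continuous G := by fun_prop
  let A : Set (ι → E × E) := {w | 0 < G w}
  have hAo : IsOpen A := isOpen_lt continuous_const hG
  have hA : MeasurableSet A := hAo.measurableSet
  let R : (ι → E × E) → (ι → E × E) := fun w i => w (σ i)
  have hR : MeasurePreserving R P P := by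
    have := measurePreserving_piCongrLeft (fun _ : ι => π) σ.symm
    convert this using 1
    ext1 w
    ext1 i
    simp [R, MeasurableEquiv.coe_piCongrLeft, Equiv.piCongrLeft_apply]
  have hRA : R ⁻¹' A = A := by
    ext w
    have : G (R w) = G w := by
      simp only [G, R]
      exact Equiv.sum_comp σ fun i => inner ℝ (w (σ i)).1 (w i).2 - inner ℝ (w i).1 (w i).2
    simp [A, this]
  have heval : ∀ i, MeasurePreserving (fun w : ι → E × E => w i) P π := fun i =>
    measurePreserving_eval (fun _ => π) i
  -- The law of each `F i` is again a plan: second coordinates are untouched, and on `A` the first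
  -- ones are those of the sample permuted by `R`, which preserves both `P` and `A`.
  let F : ι → (ι → E × E) → E × E := fun i w => if w ∈ A then ((w (σ i)).1, (w i).2) else w i
  have hF : ∀ i, Measurable (F i) := fun i =>
    Measurable.ite hA (by fun_prop) (by fun_prop)
  have hFc : ∀ i, IsCoupling α β (P.map (F i)) := by
    intro i
    constructor
    · rw [Measure.map_map measurable_fst (hF i)]
      ext B hB
      rw [Measure.map_apply (measurable_fst.comp (hF i)) hB, ← h.map_fst,
        Measure.map_apply measurable_fst hB, ← (heval i).measure_preimage
          (measurable_fst hB).nullMeasurableSet,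
        ← measure_inter_add_sdiff _ hA, ← measure_inter_add_sdiff (_ ⁻¹' (Prod.fst ⁻¹' B)) hA]
      congr 1
      · have e : (Prod.fst ∘ F i) ⁻¹' B ∩ A =
            R ⁻¹' (((fun w : ι → E × E => w i) ⁻¹' (Prod.fst ⁻¹' B)) ∩ A) := by
          rw [Set.preimage_inter, hRA]
          ext w
          simp only [F, R, Set.mem_inter_iff, Set.mem_preimage, Function.comp_apply]
          refine and_congr_left fun hw => ?_
          rw [if_pos hw]
        rw [e, hR.measure_preimage]
        exact ((measurable_pi_apply i (measurable_fst hB)).inter hA).nullMeasurableSet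
      · congr 1
        ext w
        simp only [F, Set.mem_sdiff, Set.mem_preimage, Function.comp_apply]
        refine and_congr_left fun hw => ?_
        rw [if_neg hw]
    · rw [Measure.map_map measurable_snd (hF i)]
      have e : Prod.snd ∘ F i = Prod.snd ∘ fun w : ι → E × E => w i := by
        ext1 w
        by_cases hw : w ∈ A <;> simp [F, hw]
      rw [e, ← Measure.map_map measurable_snd (measurable_pi_apply i), (heval i).map_eq, h.map_snd]
  have hinteg : ∀ i, Integrable (fun w => inner ℝ (F i w).1 (F i w).2) P := fun i =>
    ((hFc i).integrable_inner hα2 hβ2).comp_measurable (hF i)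
  have hinteg₀ : ∀ i, Integrable (fun w : ι → E × E => inner ℝ (w i).1 (w i).2) P := fun i =>
    (heval i).integrable_comp_of_integrable (h.integrable_inner hα2 hβ2)
  have hle : ∀ i, ∫ w, (inner ℝ (F i w).1 (F i w).2 - inner ℝ (w i).1 (w i).2) ∂P ≤ 0 := by
    intro i
    have e1 : ∫ w, inner ℝ (F i w).1 (F i w).2 ∂P = ∫ p, inner ℝ p.1 p.2 ∂(P.map (F i)) :=
      (integral_map (f := fun p : E × E => inner ℝ p.1 p.2) (hF i).aemeasurable
        (by fun_prop)).symm
    have e2 : ∫ w, inner ℝ (w i).1 (w i).2 ∂P = ∫ p, inner ℝ p.1 p.2 ∂π := by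
      conv_rhs => rw [← (heval i).map_eq]
      exact (integral_map (f := fun p : E × E => inner ℝ p.1 p.2) (heval i).measurable.aemeasurable
        (by fun_prop)).symm
    rw [integral_sub (hinteg i) (hinteg₀ i), e1, e2]
    linarith [hmax _ (hFc i)]
  -- No single `F i` increases the correlation on average, yet the summed gain is `G > 0` on `A` and
  -- zero elsewhere; hence `P A = 0`.
  have hsum : ∀ w, ∑ i, (inner ℝ (F i w).1 (F i w).2 - inner ℝ (w i).1 (w i).2) =
      A.indicator G w := by
    intro w
    by_cases hw : w ∈ A <;> simp [F, hw, G]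
  have hzero : ∫ w, A.indicator G w ∂P ≤ 0 := by
    simp_rw [← hsum]
    rw [integral_finsetSum (f := fun i w => inner ℝ (F i w).1 (F i w).2 - inner ℝ (w i).1 (w i).2) _
      fun i _ => (hinteg i).sub (hinteg₀ i)]
    exact Finset.sum_nonpos fun i _ => hle i
  have hnonneg : ∀ w, 0 ≤ A.indicator G w := fun w =>
    Set.indicator_nonneg (fun w hw => le_of_lt hw) w
  have hI : Integrable (A.indicator G) P := by
    have := integrable_finsetSum Finset.univ fun i _ => (hinteg i).sub (hinteg₀ i)
    refine this.congr (ae_of_all _ fun w => ?_)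
    rw [← hsum w]
    simp
  have hae : A.indicator G =ᵐ[P] 0 :=
    (integral_eq_zero_iff_of_nonneg hnonneg hI).1 (le_antisymm hzero (integral_nonneg hnonneg))
  have hPA : P A = 0 := by
    refine measure_mono_null (fun w hw => ?_) (ae_iff.1 hae)
    simpa [hw] using (show G w ≠ 0 from ne_of_gt hw)
  by_contra! hlt
  have hzA : A ∈ 𝓝 z := hAo.mem_nhds (by
    simp only [A, G, Set.mem_ofPred_eq, Finset.sum_sub_distrib]
    linarith)
  rw [nhds_pi, Filter.mem_pi'] at hzA
  obtain ⟨I, t, ht, htA⟩ := hzA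
  -- A violating tuple in the support would have a product neighbourhood inside the open set `A`, of
  -- positive measure.
  have hpos : 0 < P (Set.univ.pi t) := by
    rw [Measure.pi_pi]
    exact pos_iff_ne_zero.2 (Finset.prod_ne_zero_iff.2 fun i _ =>
      ((Measure.mem_support_iff_forall _).1 (hz i) _ (ht i)).ne')
  exact hpos.ne' (measure_mono_null (fun w hw => htA fun i _ => hw i trivial) hPA)

end Quadratic

/-! ### Rockafellar's potential of a cyclically monotone set -/

section Rockafellar

variable {d : ℕ} {Γ : Set (EuclideanSpace ℝ (Fin d) × EuclideanSpace ℝ (Fin d))}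

/-- `Γ` is cyclically monotone. -/
def IsCyclicallyMonotone (Γ : Set (EuclideanSpace ℝ (Fin d) × EuclideanSpace ℝ (Fin d))) : Prop :=
  ∀ (n : ℕ) (z : Fin (n + 1) → EuclideanSpace ℝ (Fin d) × EuclideanSpace ℝ (Fin d)),
    (∀ i, z i ∈ Γ) →
      ∑ i, inner ℝ (z (finRotate (n + 1) i)).1 (z i).2 ≤ ∑ i, inner ℝ (z i).1 (z i).2

/-- `ChainValue Γ p₀ p s`: some chain `p₀, …, p` in `Γ` has total increment
`s = ∑ ⟪yᵢ, xᵢ₊₁ - xᵢ⟫`. -/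
inductive ChainValue (Γ : Set (EuclideanSpace ℝ (Fin d) × EuclideanSpace ℝ (Fin d)))
    (p₀ : EuclideanSpace ℝ (Fin d) × EuclideanSpace ℝ (Fin d)) :
    EuclideanSpace ℝ (Fin d) × EuclideanSpace ℝ (Fin d) → ℝ → Prop
  | base : ChainValue Γ p₀ p₀ 0
  | step {p q : EuclideanSpace ℝ (Fin d) × EuclideanSpace ℝ (Fin d)} {s : ℝ} :
      ChainValue Γ p₀ p s → q ∈ Γ → ChainValue Γ p₀ q (s + inner ℝ p.2 (q.1 - p.1))

theorem ChainValue.exists_chain {p₀ p : EuclideanSpace ℝ (Fin d) × EuclideanSpace ℝ (Fin d)}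
    {s : ℝ} (h₀ : p₀ ∈ Γ) (h : ChainValue Γ p₀ p s) :
    ∃ (n : ℕ) (z : ℕ → EuclideanSpace ℝ (Fin d) × EuclideanSpace ℝ (Fin d)),
      z 0 = p₀ ∧ z n = p ∧ (∀ i, i ≤ n → z i ∈ Γ) ∧
        s = ∑ i ∈ Finset.range n, inner ℝ (z i).2 ((z (i + 1)).1 - (z i).1) := by
  induction h with
  | base => exact ⟨0, fun _ => p₀, rfl, rfl, fun _ _ => h₀, by simp⟩
  | @step p q s _ hq ih =>
    obtain ⟨n, z, hz0, hzn, hzΓ, hs⟩ := ih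
    refine ⟨n + 1, Function.update z (n + 1) q, ?_, by simp, fun i hi => ?_, ?_⟩
    · rw [Function.update_of_ne (by omega), hz0]
    · rcases eq_or_ne i (n + 1) with rfl | hne
      · simpa using hq
      · rw [Function.update_of_ne hne]
        exact hzΓ i (by omega)
    · rw [Finset.sum_range_succ, hs, Function.update_self,
        Function.update_of_ne (by omega : n ≠ n + 1), hzn]
      congr 1
      refine Finset.sum_congr rfl fun i hi => ?_
      have := Finset.mem_range.1 hi
      rw [Function.update_of_ne (by omega), Function.update_of_ne (by omega)]

/-- Closing the chain by a return to `p₀` makes it a cycle, whose total increment is nonpositive by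
cyclical monotonicity. This keeps the potential finite at `p₀.1`. -/
theorem ChainValue.add_inner_le_zero
    {p₀ p : EuclideanSpace ℝ (Fin d) × EuclideanSpace ℝ (Fin d)} {s : ℝ}
    (hΓ : IsCyclicallyMonotone Γ) (h₀ : p₀ ∈ Γ) (h : ChainValue Γ p₀ p s) :
    s + inner ℝ p.2 (p₀.1 - p.1) ≤ 0 := by
  obtain ⟨n, z, hz0, hzn, hzΓ, rfl⟩ := h.exists_chain h₀
  have key := hΓ n (fun i => z i) fun i => hzΓ i (by omega)
  rw [Fin.sum_univ_castSucc, Fin.sum_univ_castSucc] at key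
  simp only [finRotate_apply, Fin.last_add_one, Fin.val_last, Fin.val_castSucc,
    Fin.coeSucc_eq_succ, Fin.val_succ, Fin.val_zero, hz0, hzn] at key
  rw [Fin.sum_univ_eq_sum_range fun i => inner ℝ (z (i + 1)).1 (z i).2,
    Fin.sum_univ_eq_sum_range fun i => inner ℝ (z i).1 (z i).2] at key
  simp only [inner_sub_right, Finset.sum_sub_distrib]
  simp only [real_inner_comm] at key ⊢
  linarith

/-- The potential of Rockafellar's theorem: the supremum of the affine functions obtained by
following chains in `Γ`. -/
noncomputable def rockafellarPotential
    (Γ : Set (EuclideanSpace ℝ (Fin d) × EuclideanSpace ℝ (Fin d)))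
    (p₀ : EuclideanSpace ℝ (Fin d) × EuclideanSpace ℝ (Fin d)) (x : EuclideanSpace ℝ (Fin d)) :
    EReal :=
  ⨆ (p : EuclideanSpace ℝ (Fin d) × EuclideanSpace ℝ (Fin d)) (s : ℝ) (_ : ChainValue Γ p₀ p s),
    ((s + inner ℝ p.2 (x - p.1) : ℝ) : EReal)

theorem rockafellarPotential_le_iff {p₀ : EuclideanSpace ℝ (Fin d) × EuclideanSpace ℝ (Fin d)}
    {x : EuclideanSpace ℝ (Fin d)} {r : ℝ} :
    rockafellarPotential Γ p₀ x ≤ r ↔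
      ∀ p s, ChainValue Γ p₀ p s → s + inner ℝ p.2 (x - p.1) ≤ r := by
  simp only [rockafellarPotential, iSup_le_iff, EReal.coe_le_coe_iff]

theorem rockafellarPotential_ne_bot {p₀ : EuclideanSpace ℝ (Fin d) × EuclideanSpace ℝ (Fin d)}
    (x : EuclideanSpace ℝ (Fin d)) : rockafellarPotential Γ p₀ x ≠ ⊥ := by
  refine ne_of_gt (lt_of_lt_of_le (EReal.bot_lt_coe (0 + inner ℝ p₀.2 (x - p₀.1))) ?_)
  exact le_iSup_of_le p₀ (le_iSup_of_le 0 (le_iSup_of_le .base le_rfl))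

theorem rockafellarPotential_le_zero {p₀ : EuclideanSpace ℝ (Fin d) × EuclideanSpace ℝ (Fin d)}
    (hΓ : IsCyclicallyMonotone Γ) (h₀ : p₀ ∈ Γ) : rockafellarPotential Γ p₀ p₀.1 ≤ (0 : ℝ) :=
  rockafellarPotential_le_iff.2 fun _ _ h => h.add_inner_le_zero hΓ h₀

/-- Points of `Γ` are subgradients of the potential. -/
theorem rockafellarPotential_subgradient
    {p₀ p : EuclideanSpace ℝ (Fin d) × EuclideanSpace ℝ (Fin d)} (hp : p ∈ Γ)
    {x : EuclideanSpace ℝ (Fin d)} {r : ℝ} (hr : rockafellarPotential Γ p₀ x ≤ r) :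
    rockafellarPotential Γ p₀ p.1 ≤ ((r - inner ℝ p.2 (x - p.1) : ℝ) : EReal) := by
  rw [rockafellarPotential_le_iff] at hr ⊢
  intro q s hq
  -- Any chain ending at `q` can be prolonged by `p`, and the longer chain is also bounded at `x`.
  have := hr p _ (hq.step hp)
  linarith

theorem isProperConvex_rockafellarPotential
    {p₀ : EuclideanSpace ℝ (Fin d) × EuclideanSpace ℝ (Fin d)}
    (hΓ : IsCyclicallyMonotone Γ) (h₀ : p₀ ∈ Γ) : IsProperConvex (rockafellarPotential Γ p₀) where
  ne_bot := rockafellarPotential_ne_bot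
  exists_ne_top :=
    ⟨p₀.1, ne_of_lt ((rockafellarPotential_le_zero hΓ h₀).trans_lt (EReal.coe_lt_top _))⟩
  convex_epigraph := by
    intro v hv w hw a b ha hb hab
    simp only [Set.mem_ofPred_eq, rockafellarPotential_le_iff] at hv hw ⊢
    intro p s hp
    have h1 := mul_le_mul_of_nonneg_left (hv p s hp) ha
    have h2 := mul_le_mul_of_nonneg_left (hw p s hp) hb
    simp only [Prod.fst_add, Prod.snd_add, Prod.smul_fst, Prod.smul_snd, smul_eq_mul,
      inner_sub_right, inner_add_right, inner_smul_right] at h1 h2 ⊢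
    have hb' : b = 1 - a := by linarith
    subst hb'
    linarith

end Rockafellar

/-! ### Extended-valued convex functions: subgradients and differentiability -/

section Convex

variable {d : ℕ} {φ : EuclideanSpace ℝ (Fin d) → EReal}

/-- The effective domain. -/
def effDomain (φ : EuclideanSpace ℝ (Fin d) → EReal) : Set (EuclideanSpace ℝ (Fin d)) :=
  {x | φ x ≠ ⊤}

theorem IsProperConvex.coe_toReal (hφ : IsProperConvex φ) {x : EuclideanSpace ℝ (Fin d)}
    (hx : x ∈ effDomain φ) : ((φ x).toReal : EReal) = φ x :=
  EReal.coe_toReal hx (hφ.ne_bot x)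

/-- Epigraph convexity applied at the points `(x, φ x)`. Restricting to the effective domain avoids
the default value `0` of `EReal.toReal` at `⊤`. -/
theorem IsProperConvex.convexOn (hφ : IsProperConvex φ) :
    ConvexOn ℝ (effDomain φ) fun x => (φ x).toReal := by
  have key : ∀ x ∈ effDomain φ, ∀ y ∈ effDomain φ, ∀ a b : ℝ, 0 ≤ a → 0 ≤ b → a + b = 1 →
      φ (a • x + b • y) ≤ ((a * (φ x).toReal + b * (φ y).toReal : ℝ) : EReal) := by
    intro x hx y hy a b ha hb hab
    exact hφ.convex_epigraph (x := (x, (φ x).toReal)) (y := (y, (φ y).toReal))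
      (hφ.coe_toReal hx).ge (hφ.coe_toReal hy).ge ha hb hab
  have hD : Convex ℝ (effDomain φ) := fun x hx y hy a b ha hb hab =>
    ne_of_lt ((key x hx y hy a b ha hb hab).trans_lt (EReal.coe_lt_top _))
  refine ⟨hD, fun x hx y hy a b ha hb hab => ?_⟩
  have h := key x hx y hy a b ha hb hab
  rw [← hφ.coe_toReal (hD hx hy ha hb hab), EReal.coe_le_coe_iff] at h
  exact h

theorem HasExtGradientAt.mem_interior {g x : EuclideanSpace ℝ (Fin d)}
    (h : HasExtGradientAt φ g x) : x ∈ interior (effDomain φ) :=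
  mem_interior_iff_mem_nhds.2 (h.1.mono fun _ hz => hz.2)

/-- The gradient is a subgradient. -/
theorem HasExtGradientAt.add_inner_le (hφ : IsProperConvex φ) {g x : EuclideanSpace ℝ (Fin d)}
    (h : HasExtGradientAt φ g x) {z : EuclideanSpace ℝ (Fin d)} (hz : z ∈ effDomain φ) :
    (φ x).toReal + inner ℝ g (z - x) ≤ (φ z).toReal := by
  have hx : x ∈ effDomain φ := interior_subset h.mem_interior
  -- Along the segment from `x` to `z`, the slope over `[0, 1]` dominates the derivative at `0`.
  have hconv := hφ.convexOn.comp_affineMap (AffineMap.lineMap (k := ℝ) x z)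
  have hd : HasDerivAt ((fun x => (φ x).toReal) ∘ AffineMap.lineMap (k := ℝ) x z)
      (inner ℝ g (z - x)) 0 := by
    have h1 : HasFDerivAt (fun x => (φ x).toReal) (InnerProductSpace.toDual ℝ _ g)
        (AffineMap.lineMap (k := ℝ) x z 0) := by
      simpa using h.2.hasFDerivAt
    have h2 := h1.comp_hasDerivAt (0 : ℝ) (AffineMap.hasDerivAt_lineMap (a := x) (b := z))
    simpa using h2
  have := hconv.le_slope_of_hasDerivAt (by simpa using hx) (by simpa using hz) one_pos hd
  simp [slope_def_field] at this
  linarith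

/-- At a point of differentiability the gradient is the only subgradient. -/
theorem HasExtGradientAt.eq_of_subgradient {g x y : EuclideanSpace ℝ (Fin d)}
    (h : HasExtGradientAt φ g x)
    (hy : ∀ z ∈ effDomain φ, (φ x).toReal + inner ℝ y (z - x) ≤ (φ z).toReal) : y = g := by
  -- Subtracting the affine minorant leaves a local minimum at `x`, where the derivative must
  -- vanish.
  have hmin : IsLocalMin (fun z => (φ z).toReal - inner ℝ y z) x := by
    filter_upwards [h.1] with z hz
    have := hy z hz.2
    rw [inner_sub_right] at this
    linarith
  have hd : HasFDerivAt (fun z => (φ z).toReal - inner ℝ y z)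
      (InnerProductSpace.toDual ℝ _ g - InnerProductSpace.toDual ℝ _ y) x :=
    h.2.hasFDerivAt.sub (InnerProductSpace.toDual ℝ _ y).hasFDerivAt
  have h0 := hmin.hasFDerivAt_eq_zero hd
  exact ((InnerProductSpace.toDual ℝ _).injective (sub_eq_zero.1 h0)).symm

/-- A convex function is differentiable almost everywhere in the interior of its domain. -/
theorem _root_.ConvexOn.ae_differentiableAt_of_mem_interior {E : Type*} [NormedAddCommGroup E]
    [NormedSpace ℝ E] [FiniteDimensional ℝ E] [MeasurableSpace E] [BorelSpace E] {μ : Measure E}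
    [μ.IsAddHaarMeasure] {f : E → ℝ} {s : Set E} (hf : ConvexOn ℝ s f) :
    ∀ᵐ x ∂μ, x ∈ interior s → DifferentiableAt ℝ f x := by
  rw [ae_iff]
  refine measure_null_of_locally_null _ fun x hx => ?_
  simp only [Set.mem_ofPred_eq, Classical.not_imp] at hx
  -- Convex functions are locally Lipschitz in the interior, so Rademacher's theorem applies near
  -- each point.
  obtain ⟨K, t, ht, hK⟩ := hf.locallyLipschitzOn_interior hx.1
  rw [isOpen_interior.nhdsWithin_eq hx.1] at ht
  have hL : LipschitzOnWith K f (interior t) := hK.mono interior_subset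
  refine ⟨{y | ¬(y ∈ interior t → DifferentiableWithinAt ℝ f (interior t) y)}, ?_,
    ae_iff.1 hL.ae_differentiableWithinAt_of_mem⟩
  filter_upwards [self_mem_nhdsWithin, mem_nhdsWithin_of_mem_nhds (interior_mem_nhds.2 ht)]
    with y hy hyt h
  exact hy fun _ => (h hyt).differentiableAt (isOpen_interior.mem_nhds hyt)

theorem IsProperConvex.ae_hasExtGradientAt (hφ : IsProperConvex φ) :
    ∀ᵐ x, x ∈ interior (effDomain φ) →
      HasExtGradientAt φ (gradient (fun z => (φ z).toReal) x) x := by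
  filter_upwards [hφ.convexOn.ae_differentiableAt_of_mem_interior (μ := volume)] with x hx hxi
  refine ⟨?_, (hx hxi).hasGradientAt⟩
  filter_upwards [mem_interior_iff_mem_nhds.1 hxi] with z hz
  exact ⟨hφ.ne_bot z, hz⟩

/-- No regularity of `f` is needed, thanks to the default value of `fderiv` at points of
non-differentiability. It provides an everywhere defined Borel map. -/
theorem measurable_gradient {E : Type*} [NormedAddCommGroup E] [InnerProductSpace ℝ E]
    [FiniteDimensional ℝ E] [MeasurableSpace E] [BorelSpace E] (f : E → ℝ) :
    Measurable (gradient f) :=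
  (InnerProductSpace.toDual ℝ E).symm.continuous.measurable.comp (measurable_fderiv ℝ f)

end Convex

/-! ### Legendre duality: convex gradients are the unique optimizers -/

section Optimality

variable {d : ℕ} {φ : EuclideanSpace ℝ (Fin d) → EReal}

/-- The Legendre transform. -/
noncomputable def legendre (φ : EuclideanSpace ℝ (Fin d) → EReal) (y : EuclideanSpace ℝ (Fin d)) :
    EReal :=
  ⨆ x ∈ effDomain φ, ((inner ℝ x y - (φ x).toReal : ℝ) : EReal)

theorem measurable_legendre : Measurable (legendre φ) := by
  refine LowerSemicontinuous.measurable ?_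
  refine lowerSemicontinuous_iSup fun x => lowerSemicontinuous_iSup fun _ =>
    Continuous.lowerSemicontinuous ?_
  exact continuous_coe_real_ereal.comp (by fun_prop)

theorem le_legendre {x y : EuclideanSpace ℝ (Fin d)} (hx : x ∈ effDomain φ) :
    ((inner ℝ x y - (φ x).toReal : ℝ) : EReal) ≤ legendre φ y :=
  le_iSup₂_of_le x hx le_rfl

/-- Fenchel's inequality in real form; only `⊤` has to be excluded, since a point of the domain
keeps the transform above `⊥`. -/
theorem inner_le_add_legendre {x y : EuclideanSpace ℝ (Fin d)} (hx : x ∈ effDomain φ)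
    (hy : legendre φ y ≠ ⊤) : inner ℝ x y ≤ (φ x).toReal + (legendre φ y).toReal := by
  have h := le_legendre (y := y) hx
  rw [← EReal.coe_toReal hy (ne_of_gt ((EReal.bot_lt_coe _).trans_le h)),
    EReal.coe_le_coe_iff] at h
  linarith

theorem HasExtGradientAt.legendre_eq (hφ : IsProperConvex φ) {g x : EuclideanSpace ℝ (Fin d)}
    (h : HasExtGradientAt φ g x) :
    legendre φ g = ((inner ℝ x g - (φ x).toReal : ℝ) : EReal) := by
  refine le_antisymm (iSup₂_le fun z hz => ?_) (le_legendre (interior_subset h.mem_interior))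
  have := h.add_inner_le hφ hz
  rw [inner_sub_right, real_inner_comm, real_inner_comm x] at this
  rw [EReal.coe_le_coe_iff]
  linarith

variable {α β : Measure (EuclideanSpace ℝ (Fin d))}
  {S : EuclideanSpace ℝ (Fin d) → EuclideanSpace ℝ (Fin d)}

theorem integral_inner_graph (hS : AEMeasurable S α) :
    ∫ p, inner ℝ p.1 p.2 ∂(α.map fun x => (x, S x)) = ∫ x, inner ℝ x (S x) ∂α :=
  integral_map (f := fun p : EuclideanSpace ℝ (Fin d) × EuclideanSpace ℝ (Fin d) =>
    inner ℝ p.1 p.2) (aemeasurable_id.prodMk hS) (by fun_prop)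

theorem integrable_id_of_sq {μ : Measure (EuclideanSpace ℝ (Fin d))} [IsProbabilityMeasure μ]
    (h2 : Integrable (fun x => ‖x‖ ^ 2) μ) : Integrable (fun x => x) μ := by
  refine ((integrable_const 1).add h2).mono' (by fun_prop) (ae_of_all _ fun x => ?_)
  simp only [Pi.add_apply]
  nlinarith [sq_nonneg (‖x‖ - 1)]

/-- Integrated duality: for a transport map `S = ∇φ`, the potentials `φ` and `φ*` are integrable and
saturate the Fenchel inequality. -/
theorem IsProperConvex.integrable_potentials [IsProbabilityMeasure α] [IsProbabilityMeasure β]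
    (hφ : IsProperConvex φ)
    (hα2 : Integrable (fun x => ‖x‖ ^ 2) α) (hβ2 : Integrable (fun y => ‖y‖ ^ 2) β)
    (hS : IsTransportMap α β S) (hgrad : ∀ᵐ x ∂α, HasExtGradientAt φ (S x) x) :
    (∀ᵐ y ∂β, legendre φ y ≠ ⊤) ∧ Integrable (fun x => (φ x).toReal) α ∧
      Integrable (fun y => (legendre φ y).toReal) β ∧
      ∫ x, inner ℝ x (S x) ∂α = ∫ x, (φ x).toReal ∂α + ∫ y, (legendre φ y).toReal ∂β := by
  obtain ⟨hSm, hSβ⟩ := hS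
  have hmeas : Measurable fun y => (legendre φ y).toReal := measurable_legendre.ereal_toReal
  have hleg : ∀ᵐ x ∂α, legendre φ (S x) ≠ ⊤ := by
    filter_upwards [hgrad] with x hx
    rw [hx.legendre_eq hφ]
    exact EReal.coe_ne_top _
  have hlegβ : ∀ᵐ y ∂β, legendre φ y ≠ ⊤ := by
    rw [← hSβ, ae_map_iff (p := fun y => legendre φ y ≠ ⊤) hSm
      (measurable_legendre (measurableSet_singleton _)).compl]
    exact hleg
  have hU : ∀ᵐ x ∂α, x ∈ interior (effDomain φ) := hgrad.mono fun x hx => hx.mem_interior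
  have hfm : AEStronglyMeasurable (fun x => (φ x).toReal) α := by
    -- `φ` need not be Borel on the boundary of its domain, but it is continuous on the interior,
    -- which carries `α`.
    rw [← Measure.restrict_eq_self_of_ae_mem hU]
    exact hφ.convexOn.continuousOn_interior.aestronglyMeasurable isOpen_interior.measurableSet
  have hSi : Integrable S α := by
    have : Integrable (fun y => y) (α.map S) := by rw [hSβ]; exact integrable_id_of_sq hβ2
    exact this.comp_aemeasurable hSm
  have hxS : Integrable (fun x => inner ℝ x (S x)) α := by
    have h := (isCoupling_graph hSm).integrable_inner hα2 (by rwa [hSβ])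
    exact h.comp_aemeasurable (aemeasurable_id.prodMk hSm)
  obtain ⟨x₀, hx₀⟩ := hgrad.exists
  have hx₀D : x₀ ∈ effDomain φ := interior_subset hx₀.mem_interior
  have hfi : Integrable (fun x => (φ x).toReal) α := by
    -- Fix one good point `x₀`. Fenchel at `(x, S x₀)` bounds `φ` below by an affine function;
    -- Fenchel at `(x₀, S x)`, with equality at `(x, S x)`, bounds it above.
    refine integrable_of_le_of_le (g₁ := fun x => inner ℝ x (S x₀) - (legendre φ (S x₀)).toReal)
      (g₂ := fun x => inner ℝ x (S x) - (inner ℝ x₀ (S x) - (φ x₀).toReal)) hfm ?_ ?_ ?_ ?_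
    · filter_upwards [hU] with x hx
      have := inner_le_add_legendre (y := S x₀) (interior_subset hx)
        (by rw [hx₀.legendre_eq hφ]; exact EReal.coe_ne_top _)
      linarith
    · filter_upwards [hgrad, hleg] with x hx hxl
      have h1 := inner_le_add_legendre hx₀D hxl
      rw [hx.legendre_eq hφ, EReal.toReal_coe] at h1
      linarith
    · exact ((integrable_id_of_sq hα2).inner_const _).sub (integrable_const _)
    · exact hxS.sub ((hSi.const_inner _).sub (integrable_const _))
  have hgS : (fun x => (legendre φ (S x)).toReal) =ᵐ[α]
      fun x => inner ℝ x (S x) - (φ x).toReal := by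
    filter_upwards [hgrad] with x hx
    rw [hx.legendre_eq hφ, EReal.toReal_coe]
  have hgi : Integrable (fun y => (legendre φ y).toReal) β := by
    rw [← hSβ, integrable_map_measure hmeas.aestronglyMeasurable hSm]
    exact (hxS.sub hfi).congr hgS.symm
  refine ⟨hlegβ, hfi, hgi, ?_⟩
  rw [← hSβ, integral_map hSm hmeas.aestronglyMeasurable, integral_congr_ae hgS,
    integral_sub hxS hfi]
  ring

/-- A transport map which is the gradient of a convex function maximizes the correlation among all
transport plans, and is the only maximizer. -/
theorem IsGradientOfConvex.maximal [IsProbabilityMeasure α] [IsProbabilityMeasure β]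
    (hα2 : Integrable (fun x => ‖x‖ ^ 2) α) (hβ2 : Integrable (fun y => ‖y‖ ^ 2) β)
    (hS : IsTransportMap α β S) (hgrad : IsGradientOfConvex α S)
    {π : Measure (EuclideanSpace ℝ (Fin d) × EuclideanSpace ℝ (Fin d))} (hπ : IsCoupling α β π) :
    ∫ p, inner ℝ p.1 p.2 ∂π ≤ ∫ x, inner ℝ x (S x) ∂α ∧
      (∫ x, inner ℝ x (S x) ∂α ≤ ∫ p, inner ℝ p.1 p.2 ∂π → ∀ᵐ p ∂π, p.2 = S p.1) := by
  obtain ⟨φ, hφ, hg⟩ := hgrad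
  obtain ⟨hleg, hfi, hgi, heq⟩ := hφ.integrable_potentials hα2 hβ2 hS hg
  have hi := hπ.integrable_inner hα2 hβ2
  have hf1 := hπ.integrable_comp_fst hfi
  have hg2 := hπ.integrable_comp_snd hgi
  have hg' : ∀ᵐ p ∂π, HasExtGradientAt φ (S p.1) p.1 := by
    refine ae_of_ae_map (f := Prod.fst) (p := fun x => HasExtGradientAt φ (S x) x)
      measurable_fst.aemeasurable ?_
    rwa [hπ.map_fst]
  have hleg' : ∀ᵐ p ∂π, legendre φ p.2 ≠ ⊤ := by
    refine ae_of_ae_map (f := Prod.snd) (p := fun y => legendre φ y ≠ ⊤)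
      measurable_snd.aemeasurable ?_
    rwa [hπ.map_snd]
  have hnn : 0 ≤ᵐ[π] fun p =>
      (φ p.1).toReal + (legendre φ p.2).toReal - inner ℝ p.1 p.2 := by
    filter_upwards [hg', hleg'] with p hp hpl
    exact sub_nonneg.2 (inner_le_add_legendre (interior_subset hp.mem_interior) hpl)
  have hinteg : Integrable (fun p : EuclideanSpace ℝ (Fin d) × EuclideanSpace ℝ (Fin d) =>
      (φ p.1).toReal + (legendre φ p.2).toReal - inner ℝ p.1 p.2) π := (hf1.add hg2).sub hi
  have hval : ∫ p, ((φ p.1).toReal + (legendre φ p.2).toReal - inner ℝ p.1 p.2) ∂π =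
      ∫ x, inner ℝ x (S x) ∂α - ∫ p, inner ℝ p.1 p.2 ∂π := by
    rw [integral_sub (f := fun p : EuclideanSpace ℝ (Fin d) × EuclideanSpace ℝ (Fin d) =>
      (φ p.1).toReal + (legendre φ p.2).toReal) (hf1.add hg2) hi, integral_add hf1 hg2, heq,
      hπ.integral_comp_fst hfi, hπ.integral_comp_snd hgi]
  have hnn' := integral_nonneg_of_ae hnn
  refine ⟨by linarith, fun hle => ?_⟩
  have hzero := (integral_eq_zero_iff_of_nonneg_ae hnn hinteg).1 (by linarith)
  -- Equality of integrals kills the nonnegative Fenchel gap almost everywhere; a zero gap at `p`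
  -- says that `p.2` is a subgradient at `p.1`.
  filter_upwards [hzero, hg', hleg'] with p hp hpg hpl
  refine hpg.eq_of_subgradient fun z hz => ?_
  have h1 := inner_le_add_legendre hz hpl
  simp only [Pi.zero_apply] at hp
  rw [inner_sub_right, real_inner_comm, real_inner_comm p.1]
  linarith

theorem mongeCost_eq (hS : AEMeasurable S α) :
    mongeCost α S = ∫⁻ p, ‖p.1 - p.2‖ₑ ^ 2 ∂(α.map fun x => (x, S x)) :=
  (lintegral_map' (f := fun p : EuclideanSpace ℝ (Fin d) × EuclideanSpace ℝ (Fin d) =>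
    ‖p.1 - p.2‖ₑ ^ 2) (by fun_prop) (aemeasurable_id.prodMk hS)).symm

theorem IsTransportMap.isCoupling (hS : IsTransportMap α β S) :
    IsCoupling α β (α.map fun x => (x, S x)) :=
  hS.2 ▸ isCoupling_graph hS.1

theorem mongeCost_le_iff {T : EuclideanSpace ℝ (Fin d) → EuclideanSpace ℝ (Fin d)}
    (hα2 : Integrable (fun x => ‖x‖ ^ 2) α) (hβ2 : Integrable (fun y => ‖y‖ ^ 2) β)
    (hS : IsTransportMap α β S) (hT : IsTransportMap α β T) :
    mongeCost α S ≤ mongeCost α T ↔ ∫ x, inner ℝ x (T x) ∂α ≤ ∫ x, inner ℝ x (S x) ∂α := by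
  rw [mongeCost_eq hS.1, mongeCost_eq hT.1, hS.isCoupling.lintegral_le_iff hT.isCoupling hα2 hβ2,
    integral_inner_graph hS.1, integral_inner_graph hT.1]

theorem IsGradientOfConvex.isOptimalMongeMap [IsProbabilityMeasure α] [IsProbabilityMeasure β]
    (hα2 : Integrable (fun x => ‖x‖ ^ 2) α) (hβ2 : Integrable (fun y => ‖y‖ ^ 2) β)
    (hS : IsTransportMap α β S) (hgrad : IsGradientOfConvex α S) : IsOptimalMongeMap α β S := by
  refine ⟨hS, fun T hT => (mongeCost_le_iff hα2 hβ2 hS hT).2 ?_⟩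
  rw [← integral_inner_graph hT.1]
  exact (hgrad.maximal hα2 hβ2 hS hT.isCoupling).1

theorem IsGradientOfConvex.eq_of_isOptimalMongeMap [IsProbabilityMeasure α]
    [IsProbabilityMeasure β] {T : EuclideanSpace ℝ (Fin d) → EuclideanSpace ℝ (Fin d)}
    (hα2 : Integrable (fun x => ‖x‖ ^ 2) α) (hβ2 : Integrable (fun y => ‖y‖ ^ 2) β)
    (hT : IsTransportMap α β T) (hgrad : IsGradientOfConvex α T) (hS : IsOptimalMongeMap α β S) :
    S =ᵐ[α] T := by
  have h := (hgrad.maximal hα2 hβ2 hT hS.1.isCoupling).2 (by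
    rw [integral_inner_graph hS.1.1]
    exact (mongeCost_le_iff hα2 hβ2 hS.1 hT).1 (hS.2 T hT))
  exact ae_of_ae_map (aemeasurable_id.prodMk hS.1.1) h

theorem IsGradientOfConvex.congr {T : EuclideanSpace ℝ (Fin d) → EuclideanSpace ℝ (Fin d)}
    (hT : IsGradientOfConvex α T) (h : S =ᵐ[α] T) : IsGradientOfConvex α S := by
  obtain ⟨φ, hφ, hg⟩ := hT
  refine ⟨φ, hφ, ?_⟩
  filter_upwards [hg, h] with x hx hxS
  rwa [hxS]

end Optimality

/-! ### Construction of the Monge map -/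

section Existence

variable {d : ℕ} {α β : Measure (EuclideanSpace ℝ (Fin d))}

theorem HasLebesgueDensity.absolutelyContinuous (hα : HasLebesgueDensity α) : α ≪ volume := by
  obtain ⟨ρ, -, rfl⟩ := hα
  exact withDensity_absolutelyContinuous _ _

/-- Existence of a convex potential whose gradient transports `α` to `β`. -/
theorem exists_gradientOfConvex_transportMap [IsProbabilityMeasure α] [IsProbabilityMeasure β]
    (hα2 : Integrable (fun x => ‖x‖ ^ 2) α) (hβ2 : Integrable (fun y => ‖y‖ ^ 2) β)
    (hα : α ≪ volume) :
    ∃ T, Measurable T ∧ IsTransportMap α β T ∧ IsGradientOfConvex α T := by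
  obtain ⟨π, hπ, hmax⟩ := exists_maximal_coupling α β hα2 hβ2
  have := hπ.isProbabilityMeasure
  have hΓ : IsCyclicallyMonotone π.support := fun n z hz =>
    hπ.sum_inner_perm_le hα2 hβ2 hmax (finRotate (n + 1)) z hz
  obtain ⟨p₀, h₀⟩ := Measure.nonempty_support (IsProbabilityMeasure.ne_zero π)
  set φ := rockafellarPotential π.support p₀ with hφdef
  have hφ : IsProperConvex φ := isProperConvex_rockafellarPotential hΓ h₀
  have hmem : ∀ p ∈ π.support, p.1 ∈ effDomain φ := fun p hp =>
    ne_of_lt ((rockafellarPotential_subgradient hp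
      (rockafellarPotential_le_zero hΓ h₀)).trans_lt (EReal.coe_lt_top _))
  have hsupp : ∀ᵐ p ∂π, p ∈ π.support := Measure.support_mem_ae
  -- The closure is used because it is measurable, as transfer to the marginal requires; it differs
  -- from the interior by the frontier, which is Lebesgue-null by convexity.
  have hclos : ∀ᵐ x ∂α, x ∈ closure (effDomain φ) := by
    rw [← hπ.map_fst, ae_map_iff (p := fun x => x ∈ closure (effDomain φ))
      measurable_fst.aemeasurable isClosed_closure.measurableSet]
    exact hsupp.mono fun p hp => subset_closure (hmem p hp)
  have hfront : ∀ᵐ x ∂α, x ∉ frontier (effDomain φ) :=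
    hα (measure_eq_zero_iff_ae_notMem.1 (hφ.convexOn.1.addHaar_frontier volume))
  have hgrad : ∀ᵐ x ∂α, HasExtGradientAt φ (gradient (fun z => (φ z).toReal) x) x := by
    filter_upwards [hclos, hfront, hα hφ.ae_hasExtGradientAt] with x hx hxf hxd
    refine hxd ?_
    by_contra hxi
    exact hxf ⟨hx, hxi⟩
  have hgradπ : ∀ᵐ p ∂π, HasExtGradientAt φ (gradient (fun z => (φ z).toReal) p.1) p.1 := by
    refine ae_of_ae_map (f := Prod.fst)
      (p := fun x => HasExtGradientAt φ (gradient (fun z => (φ z).toReal) x) x)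
      measurable_fst.aemeasurable ?_
    rwa [hπ.map_fst]
  have hT : Measurable (gradient fun z => (φ z).toReal) := measurable_gradient _
  refine ⟨gradient fun z => (φ z).toReal, hT, ⟨hT.aemeasurable, ?_⟩, φ, hφ, hgrad⟩
  -- Support points are subgradients of `φ`, hence gradients wherever `φ` is differentiable: the
  -- plan is concentrated on a graph.
  have hgraph : Prod.snd =ᵐ[π] (gradient fun z => (φ z).toReal) ∘ Prod.fst := by
    filter_upwards [hsupp, hgradπ] with p hp hpg
    refine hpg.eq_of_subgradient fun z hz => ?_
    have h := rockafellarPotential_subgradient hp (hφ.coe_toReal hz).ge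
    rw [← hφdef, ← hφ.coe_toReal (hmem p hp), EReal.coe_le_coe_iff] at h
    linarith
  rw [← hπ.map_snd, Measure.map_congr hgraph, ← Measure.map_map hT measurable_fst, hπ.map_fst]

end Existence

end Brenier

/-! ### Brenier's theorem -/

theorem mainTheorem1 (d : ℕ)
    (α β : Measure (EuclideanSpace ℝ (Fin d))) [IsProbabilityMeasure α] [IsProbabilityMeasure β]
    (hα2 : Integrable (fun x => ‖x‖ ^ 2) α) (hβ2 : Integrable (fun y => ‖y‖ ^ 2) β)
    (hα : Brenier.HasLebesgueDensity α) :
    ∃ T : EuclideanSpace ℝ (Fin d) → EuclideanSpace ℝ (Fin d),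
      -- existence and uniqueness of the optimal Monge map
      Measurable T ∧ Brenier.IsOptimalMongeMap α β T ∧
      (∀ S, Brenier.IsOptimalMongeMap α β S → S =ᵐ[α] T) ∧
      -- it is the unique gradient of a convex function that pushes `α` to `β`
      Brenier.IsGradientOfConvex α T ∧
      (∀ S, Brenier.IsTransportMap α β S → Brenier.IsGradientOfConvex α S → S =ᵐ[α] T) ∧
      -- and these two properties characterize optimality
      (∀ S, Brenier.IsOptimalMongeMap α β S ↔
        Brenier.IsTransportMap α β S ∧ Brenier.IsGradientOfConvex α S) := by

  obtain ⟨T, hTm, hT, hTg⟩ :=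
    Brenier.exists_gradientOfConvex_transportMap (β := β) hα2 hβ2 hα.absolutelyContinuous
  have huniq : ∀ S, Brenier.IsOptimalMongeMap α β S → S =ᵐ[α] T := fun S hS =>
    hTg.eq_of_isOptimalMongeMap hα2 hβ2 hT hS
  have hopt : ∀ S, Brenier.IsTransportMap α β S → Brenier.IsGradientOfConvex α S →
      Brenier.IsOptimalMongeMap α β S := fun S hS hSg => hSg.isOptimalMongeMap hα2 hβ2 hS
  exact ⟨T, hTm, hopt T hT hTg, huniq, hTg, fun S hS hSg => huniq S (hopt S hS hSg),
    fun S => ⟨fun hS => ⟨hS.1, hTg.congr (huniq S hS)⟩, fun hS => hopt S hS.1 hS.2⟩⟩
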